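/- **Setting.** A *physical system* $\mathfrak S$ consists of a nonempty set $\mathcal O$ of observables, a set $\mathcal S$ of states with a distinguished null state $0$ and at least one other element, maps $T_{(\Delta;A)}:\mathcal S\to\mathcal S$ for $\Delta\subset\mathbb R$ Borel and $A\in\mathcal O$, with $T_{(\Delta;A)}(\rho)=0$ if $\Delta=\varnothing$ or $\rho=0$, and Borel measures $P_\rho(\,\cdot\,;A)$ on $\mathbb R$ which are probability measures for $\rho\ne 0$ and zero for $\rho=0$. Below "state" means non-null state, $P_\rho(\alpha;A)$ means $P_\rho(\{\alpha\};A)$, $T_{(\alpha;A)}$ means $T_{(\{\alpha\};A)}$, and $0/0=0$. The spectrum $\sigma(A)$ is the intersection of all Borel sets $\Delta$ with $P_\rho(\Delta;A)=1$ for all states $\rho$. The system is *finite-dimensional* if every $\sigma(A)$ is finite with $P_\rho(\sigma(A);A)=1$ for all states $\rho$, and $n=\dim\mathfrak S:=\sup_A|\sigma(A)|<\infty$. Events are pairs $(\Delta;A)$ with $\varnothing\neq\Delta\subset\sigma(A)$. The probability of a sequence of events is $P_\rho((\Delta_1;A_1),\dots,(\Delta_m;A_m))=\prod_{i}P_{\rho_{i-1}}(\Delta_i;A_i)$,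 where $\rho_0=\rho$, $\rho_i=T_{(\Delta_i;A_i)}(\rho_{i-1})$. For $f:\sigma(A)\to\sigma(B)$ write $B=f(A)$ if $P_\rho(\Gamma;B)=P_\rho(f^{-1}(\Gamma);A)$ for all states $\rho$ and all $\Gamma\subset\sigma(B)$. Observables $A,B$ are *compatible* if $A=f(C)$, $B=g(C)$ for some $C,f,g$ (a *cone*). They *commute* if $P_\rho(\Delta;A)P_{T_{(\Delta;A)}(\rho)}(\Gamma;B)=P_\rho(\Gamma;B)P_{T_{(\Gamma;B)}(\rho)}(\Delta;A)$ for all states $\rho$ and all $\Delta\subset\sigma(A)$, $\Gamma\subset\sigma(B)$. A *projection* is an observable of the form $E=\chi_\Delta(A)$ with $\Delta\subset\sigma(A)$, and $\langle E\rangle_\rho:=P_\rho(1;E)$. The product $E\circ F$ of compatible projections is the observable equal to $(f\cdot g)(C)$ for every cone $E=f(C)$, $F=g(C)$; the zero observable $0$ is the one equal to $\chi_\varnothing(A)$ for all $A$; and $T_E:=T_{(1;E)}$, where $T_E\equiv 0$ if $1\notin\sigma(E)$. An observable $A$ is nondegenerate if $|\sigma(A)|=n$. A completely mixed state is a state $\emptyset$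 with $P_\emptyset(\alpha;A)=1/n$ for all nondegenerate $A$ and all $\alpha\in\sigma(A)$. A projection is rank-$1$ if it equals $\chi_{\{\alpha\}}(A)$ for some nondegenerate $A$ and $\alpha\in\sigma(A)$; the pure states are the states $\emptyset_E:=T_E(\emptyset)$ with $E$ rank-$1$. Assume that $\mathfrak S$ is finite-dimensional and satisfies the following postulates. 1. (Separability) Observables with the same distribution in all states are equal, and states giving the same distribution to all observables are equal. 2. (Subjective update) $\mathcal S\setminus\{0\}$ is closed under convex combinations and $\rho\mapsto P_\rho$ preserves them; and $P_{T_{(\Delta;A)}(\rho)}(s)=\sum_{\alpha\in\Delta}\frac{P_\rho(\alpha;A)}{P_\rho(\Delta;A)}P_{T_{(\alpha;A)}(\rho)}(s)$ for every event $(\Delta;A)$, state $\rho$ and nonempty finite sequence of events $s$. 3. (Self-compatibility) $P_{T_{(\alpha;A)}(\rho)}(\Delta;A)=P_\rho(\Delta\cap\{\alpha\};A)/P_\rho(\alpha;A)$ and $T_{(\alpha;A)}\circ T_{(\alpha';A)}=\delta_{\alpha,\alpha'}T_{(\alpha;A)}$ for all $\alpha,\alpha'\in\sigma(A)$, all $\Delta\subset\sigma(A)$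 and all states $\rho$. 4. (Observables and states) Every degenerate observable is a non-injective function of a nondegenerate one; for $A$ nondegenerate and $f:\sigma(A)\to\mathbb R$ there is an observable $f(A)$; a completely mixed state $\emptyset$ exists; and every state is a convex combination of states obtained from $\emptyset$ by finitely many updates by events. 5. (Compatibility) If $A=f(C)$ and $B=g(C)$, then $P_\rho((\Delta;A),(\Gamma;B))=P_\rho(f^{-1}(\Delta)\cap g^{-1}(\Gamma);C)$ for all states $\rho$, $\Delta\subset\sigma(A)$, $\Gamma\subset\sigma(B)$, and $T_{(\alpha;A)}\circ T_{(\beta;B)}=T_{\chi_{\{\alpha\}}(A)\circ\chi_{\{\beta\}}(B)}$ for all $\alpha\in\sigma(A)$, $\beta\in\sigma(B)$. 6. (Commutativity) Commuting observables are compatible. 7. (Eigenstates) If $F$ is rank-$1$ and $P_{\emptyset_F}(\alpha;A)=1$ for some $\alpha\in\sigma(A)$, then $F$ and $A$ are compatible; if $A$ is nondegenerate and a state $\rho$ has $P_\rho(\alpha;A)=1$ for some $\alpha\in\sigma(A)$, then $\rho$ is pure. 8. (Symmetry of transition probabilities) $\langle F\rangle_{\emptyset_E}=\langle E\rangle_{\emptyset_F}$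 for all rank-$1$ projections $E,F$. For projections $E,F$ write $E\le F$ if $E,F$ are compatible and $E\circ F=E$, and $E\perp F$ if $E,F$ are compatible and $E\circ F=0$. **Proposition (Ordering).** (i) For all projections $E,F$: $E\le F$ if and only if $\langle E\rangle_\rho\le\langle F\rangle_\rho$ for every state $\rho$. (ii) The relation $\le$ is a partial order on the set of projections (reflexive, antisymmetric and transitive). (iii) For all projections $E,F$: $E\perp F$ if and only if $\langle E\rangle_\rho+\langle F\rangle_\rho\le 1$ for every state $\rho$. -/

import Mathlib

open Set MeasureTheory
open scoped NNReal

universe u v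

/-- A physical system with observables `𝒪` and states `𝒮` (the null state `null` included).
`T Δ A` is the state update due to the event `(Δ; A)` and `P ρ A` is the Borel measure on `ℝ`
that the state `ρ` assigns to the observable `A`. Only Borel sets `Δ` matter. -/
structure PhysicalSystem (𝒪 : Type u) (𝒮 : Type v) where
  null : 𝒮
  T : Set ℝ → 𝒪 → 𝒮 → 𝒮
  P : 𝒮 → 𝒪 → Measure ℝ
  nonempty_obs : Nonempty 𝒪
  exists_state : ∃ ρ : 𝒮, ρ ≠ null
  T_empty : ∀ A ρ, T ∅ A ρ = null
  T_null : ∀ Δ A, MeasurableSet Δ → T Δ A null = null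
  P_null : ∀ A, P null A = 0
  P_prob : ∀ ρ A, ρ ≠ null → IsProbabilityMeasure (P ρ A)

namespace PhysicalSystem

variable {𝒪 : Type u} {𝒮 : Type v}

/-- `P_ρ(Δ; A)` as a real number. -/
noncomputable def prob (S : PhysicalSystem 𝒪 𝒮) (ρ : 𝒮) (A : 𝒪) (Δ : Set ℝ) : ℝ :=
  (S.P ρ A).real Δ

/-- The spectrum `σ(A)`: the intersection of all Borel sets having probability one in every
(non-null) state. -/
def spectrum (S : PhysicalSystem 𝒪 𝒮) (A : 𝒪) : Set ℝ :=
  ⋂₀ {Δ | MeasurableSet Δ ∧ ∀ ρ, ρ ≠ S.null → S.P ρ A Δ = 1}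

/-- The dimension of the system: the supremum of the cardinalities of the spectra. -/
noncomputable def dim (S : PhysicalSystem 𝒪 𝒮) : ℕ :=
  sSup (Set.range fun A : 𝒪 => (S.spectrum A).ncard)

/-- Finite-dimensional systems: every spectrum is a finite set, which carries all the
probability, and the cardinalities of the spectra are bounded. -/
structure FiniteDimensional (S : PhysicalSystem 𝒪 𝒮) : Prop where
  finite_spectrum : ∀ A, (S.spectrum A).Finite
  prob_spectrum : ∀ ρ A, ρ ≠ S.null → S.P ρ A (S.spectrum A) = 1
  bddAbove_card : BddAbove (Set.range fun A : 𝒪 => (S.spectrum A).ncard)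

/-- An observable event `(Δ; A)`, `∅ ≠ Δ ⊆ σ(A)`. -/
def IsEvent (S : PhysicalSystem 𝒪 𝒮) (e : Set ℝ × 𝒪) : Prop :=
  e.1 ⊆ S.spectrum e.2 ∧ e.1.Nonempty

/-- The update determined by a sequence of events, the head of the list occurring first. -/
def seqUpdate (S : PhysicalSystem 𝒪 𝒮) : List (Set ℝ × 𝒪) → 𝒮 → 𝒮
  | [], ρ => ρ
  | e :: l, ρ => S.seqUpdate l (S.T e.1 e.2 ρ)

/-- The probability `∏ᵢ P_ρ(Aᵢ^{Δᵢ} | (A_k^{Δ_k})_{k < i})` of a sequence of events, the head of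
the list occurring first. -/
noncomputable def seqProb (S : PhysicalSystem 𝒪 𝒮) : List (Set ℝ × 𝒪) → 𝒮 → ℝ
  | [], _ => 1
  | e :: l, ρ => S.prob ρ e.2 e.1 * S.seqProb l (S.T e.1 e.2 ρ)

/-- `B = f(A)`: `f` maps `σ(A)` to `σ(B)` and, in every state, the distribution of `B` is the
pushforward along `f` of that of `A`. Only the restriction of `f` to `σ(A)` matters. -/
def IsFunctionVia (S : PhysicalSystem 𝒪 𝒮) (B A : 𝒪) (f : ℝ → ℝ) : Prop :=
  MapsTo f (S.spectrum A) (S.spectrum B) ∧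
    ∀ ρ, ρ ≠ S.null → ∀ Γ ⊆ S.spectrum B,
      S.prob ρ B Γ = S.prob ρ A (S.spectrum A ∩ f ⁻¹' Γ)

/-- The characteristic function of `Δ`. -/
noncomputable def chi (Δ : Set ℝ) : ℝ → ℝ := Δ.indicator fun _ => 1

/-- Two observables are compatible if they are functions of a common observable. -/
def Compatible (S : PhysicalSystem 𝒪 𝒮) (A B : 𝒪) : Prop :=
  ∃ C f g, S.IsFunctionVia A C f ∧ S.IsFunctionVia B C g

/-- Two observables commute if they satisfy the Bayes rule. -/
def Commutes (S : PhysicalSystem 𝒪 𝒮) (A B : 𝒪) : Prop :=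
  ∀ ρ, ρ ≠ S.null → ∀ Δ ⊆ S.spectrum A, ∀ Γ ⊆ S.spectrum B,
    S.prob ρ A Δ * S.prob (S.T Δ A ρ) B Γ = S.prob ρ B Γ * S.prob (S.T Γ B ρ) A Δ

/-- `E` is a projection: `E = χ_Δ(A)` for some event `Δ ⊆ σ(A)`. -/
def IsProjection (S : PhysicalSystem 𝒪 𝒮) (E : 𝒪) : Prop :=
  ∃ A, ∃ Δ ⊆ S.spectrum A, S.IsFunctionVia E A (chi Δ)

/-- The expectation `⟨E⟩_ρ = P_ρ({1}; E)` of a projection. -/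
noncomputable def expect (S : PhysicalSystem 𝒪 𝒮) (ρ : 𝒮) (E : 𝒪) : ℝ := S.prob ρ E {1}

/-- `G = E ∘ F`: `E` and `F` are compatible and `G = (f · g)(C)` for every cone
`E = f(C)`, `F = g(C)`. -/
def IsProduct (S : PhysicalSystem 𝒪 𝒮) (E F G : 𝒪) : Prop :=
  S.Compatible E F ∧
    ∀ C f g, S.IsFunctionVia E C f → S.IsFunctionVia F C g → S.IsFunctionVia G C (f * g)

/-- `Z` is the zero observable: `Z = χ_∅(A)` for every `A`. -/
def IsZero (S : PhysicalSystem 𝒪 𝒮) (Z : 𝒪) : Prop :=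
  ∀ A, S.IsFunctionVia Z A (chi ∅)

/-- `E ≤ F`: `E` and `F` are compatible and `E ∘ F = E`. -/
def Le (S : PhysicalSystem 𝒪 𝒮) (E F : 𝒪) : Prop :=
  S.IsProduct E F E

/-- `E ⊥ F`: `E` and `F` are compatible and `E ∘ F = 0`. -/
def Orthogonal (S : PhysicalSystem 𝒪 𝒮) (E F : 𝒪) : Prop :=
  ∃ Z, S.IsZero Z ∧ S.IsProduct E F Z

/-- The update `T_E` of a projection `E`, given by the event `(1; E)`; it is the trivial update
`ρ ↦ null` if `1 ∉ σ(E)`, that is, if `E` is zero. -/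
def projUpdate (S : PhysicalSystem 𝒪 𝒮) (E : 𝒪) (ρ : 𝒮) : 𝒮 :=
  S.T ({1} ∩ S.spectrum E) E ρ

/-- An observable is nondegenerate if its spectrum has `dim` elements. -/
def Nondegenerate (S : PhysicalSystem 𝒪 𝒮) (A : 𝒪) : Prop :=
  (S.spectrum A).ncard = S.dim

/-- The completely mixed state: uniform on the spectrum of each nondegenerate observable. -/
def IsCompletelyMixed (S : PhysicalSystem 𝒪 𝒮) (m : 𝒮) : Prop :=
  m ≠ S.null ∧ ∀ A, S.Nondegenerate A → ∀ α ∈ S.spectrum A, S.prob m A {α} = 1 / (S.dim : ℝ)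

/-- Experimentally accessible states: those obtained from the completely mixed state by a finite
(possibly empty) sequence of updates. -/
def IsAccessible (S : PhysicalSystem 𝒪 𝒮) (ρ : 𝒮) : Prop :=
  ρ ≠ S.null ∧ ∃ m, S.IsCompletelyMixed m ∧
    ∃ l : List (Set ℝ × 𝒪), (∀ e ∈ l, S.IsEvent e) ∧ ρ = S.seqUpdate l m

/-- Rank-one projections: `E = χ_Δ(A)` with `A` nondegenerate and `Δ ⊆ σ(A)` a one-point set. -/
def IsRankOne (S : PhysicalSystem 𝒪 𝒮) (E : 𝒪) : Prop :=
  ∃ A, S.Nondegenerate A ∧ ∃ Δ ⊆ S.spectrum A, Δ.ncard = 1 ∧ S.IsFunctionVia E A (chi Δ)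

/-- Pure states: the updates `T_E(m)` of the completely mixed state by rank-one projections. -/
def IsPure (S : PhysicalSystem 𝒪 𝒮) (ρ : 𝒮) : Prop :=
  ∃ m E, S.IsCompletelyMixed m ∧ S.IsRankOne E ∧ ρ = S.projUpdate E m

/-- Separability: states separate observables and observables separate states. -/
structure Separability (S : PhysicalSystem 𝒪 𝒮) : Prop where
  obs_ext : ∀ A B, (∀ ρ, ρ ≠ S.null → S.P ρ A = S.P ρ B) → A = B
  state_ext : ∀ ρ ρ', (∀ A, S.P ρ A = S.P ρ' A) → ρ = ρ'

/-- Subjective update: (non-null) states are closed under convex combinations, which are formed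
at the level of the probabilities they assign, and updates by an event are mixtures of the
updates by its points. -/
structure SubjectiveUpdate (S : PhysicalSystem 𝒪 𝒮) : Prop where
  convex : ∀ ρ₁ ρ₂, ρ₁ ≠ S.null → ρ₂ ≠ S.null → ∀ s t : ℝ≥0, s + t = 1 →
    ∃ ρ, ρ ≠ S.null ∧ ∀ A, S.P ρ A = s • S.P ρ₁ A + t • S.P ρ₂ A
  update : ∀ (A : 𝒪) (Δ : Finset ℝ), (Δ : Set ℝ) ⊆ S.spectrum A → Δ.Nonempty →
    ∀ ρ, ρ ≠ S.null → ∀ l : List (Set ℝ × 𝒪), l ≠ [] → (∀ e ∈ l, S.IsEvent e) →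
      S.seqProb l (S.T (Δ : Set ℝ) A ρ) =
        ∑ α ∈ Δ, S.prob ρ A {α} / S.prob ρ A (Δ : Set ℝ) * S.seqProb l (S.T {α} A ρ)

/-- Self-compatibility, with the convention `0 / 0 = 0`. -/
structure SelfCompatibility (S : PhysicalSystem 𝒪 𝒮) : Prop where
  cond : ∀ A, ∀ α ∈ S.spectrum A, ∀ ρ, ρ ≠ S.null → ∀ Δ ⊆ S.spectrum A,
    S.prob (S.T {α} A ρ) A Δ = S.prob ρ A (Δ ∩ {α}) / S.prob ρ A {α}
  update_self : ∀ A, ∀ α ∈ S.spectrum A, ∀ ρ, S.T {α} A (S.T {α} A ρ) = S.T {α} A ρ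
  update_ne : ∀ A, ∀ α ∈ S.spectrum A, ∀ α' ∈ S.spectrum A, α ≠ α' →
    ∀ ρ, S.T {α} A (S.T {α'} A ρ) = S.null

/-- Observables and states. -/
structure ObservablesAndStates (S : PhysicalSystem 𝒪 𝒮) : Prop where
  coarse_graining : ∀ A, ¬ S.Nondegenerate A →
    ∃ C f, S.Nondegenerate C ∧ S.IsFunctionVia A C f ∧ ¬ InjOn f (S.spectrum C)
  functions : ∀ A, S.Nondegenerate A → ∀ f : ℝ → ℝ, ∃ B, S.IsFunctionVia B A f
  exists_mixed : ∃ m, S.IsCompletelyMixed m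
  convex_hull : ∀ ρ, ρ ≠ S.null → ∃ (k : ℕ) (w : Fin k → ℝ≥0) (r : Fin k → 𝒮),
    (∑ i, w i = 1) ∧ (∀ i, S.IsAccessible (r i)) ∧ ∀ A, S.P ρ A = ∑ i, w i • S.P (r i) A

/-- Compatibility: the sequential distribution of compatible observables is the pushforward of
the distribution of any cone, and sequential updates are updates by product projections. -/
structure CompatibilityPostulate (S : PhysicalSystem 𝒪 𝒮) : Prop where
  pushforward : ∀ A B C f g, S.IsFunctionVia A C f → S.IsFunctionVia B C g →
    ∀ ρ, ρ ≠ S.null → ∀ Δ ⊆ S.spectrum A, ∀ Γ ⊆ S.spectrum B,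
      S.seqProb [(Δ, A), (Γ, B)] ρ = S.prob ρ C (S.spectrum C ∩ (f ⁻¹' Δ ∩ g ⁻¹' Γ))
  update : ∀ A B, S.Compatible A B → ∀ α ∈ S.spectrum A, ∀ β ∈ S.spectrum B, ∀ E F G,
    S.IsFunctionVia E A (chi {α}) → S.IsFunctionVia F B (chi {β}) → S.IsProduct E F G →
      ∀ ρ, S.T {α} A (S.T {β} B ρ) = S.projUpdate G ρ

/-- Eigenstates: a pure state `T_F(m)` predicting an outcome of `A` with certainty comes from an
`F` compatible with `A`, and only pure states predict nondegenerate observables. -/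
structure EigenstatePostulate (S : PhysicalSystem 𝒪 𝒮) : Prop where
  compatible : ∀ m, S.IsCompletelyMixed m → ∀ F, S.IsRankOne F → ∀ A, ∀ α ∈ S.spectrum A,
    S.prob (S.projUpdate F m) A {α} = 1 → S.Compatible F A
  pure : ∀ A, S.Nondegenerate A → ∀ ρ, ρ ≠ S.null → ∀ α ∈ S.spectrum A,
    S.prob ρ A {α} = 1 → S.IsPure ρ

/-- The postulates on the system: separability, subjective update, self-compatibility,
observables and states, compatibility, commuting observables are compatible, eigenstates, and
symmetry of the transition probabilities `P(E → F) = ⟨F⟩_{T_E(m)}` of rank-one projections. -/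
structure Postulates (S : PhysicalSystem 𝒪 𝒮) : Prop where
  separability : S.Separability
  subjectiveUpdate : S.SubjectiveUpdate
  selfCompatibility : S.SelfCompatibility
  observables : S.ObservablesAndStates
  compatibility : S.CompatibilityPostulate
  commutativity : ∀ A B, S.Commutes A B → S.Compatible A B
  eigenstates : S.EigenstatePostulate
  transition_symm : ∀ m, S.IsCompletelyMixed m → ∀ E F, S.IsRankOne E → S.IsRankOne F →
    S.expect (S.projUpdate E m) F = S.expect (S.projUpdate F m) E

end PhysicalSystem

/-! Say that the outcome `x` of `X` *implies* the outcome `y` of `Y` if every state that is certain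
of the former is certain of the latter. The key point is that such an implication already forces
`P_ρ(x; X) ≤ P_ρ(y; Y)` in every state, and makes `X` and `Y` compatible if both are two-valued.

If `X` is nondegenerate, the rank-one projection `χ_{x}(X)` has a pure state which is certain of
`y`, so the projection is compatible with `Y` by the eigenstate postulate. Compatible observables
commute, and since `x` implies `y` the Bayes rule reads `P_ρ(y; Y) P_{T_y ρ}(x; X) = P_ρ(x; X)`.
This identity is additive in `x`, hence holds for every `X`, being a function of a nondegenerate
observable. For two-valued observables the identity, applied to the implication and to its
contrapositive, yields the full Bayes rule, so that `X` and `Y` commute and are therefore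
compatible.

In a cone `E = f(C)`, `F = g(C)`, implications between outcomes are pointwise implications between
the values of `f` and `g` on `σ(C)`. Hence `E ≤ F` means that `E = 1` implies `F = 1`, and `E ⊥ F`
means that `E = 1` implies `F = 0`. -/

namespace PhysicalSystem

variable {𝒪 : Type u} {𝒮 : Type v} {S : PhysicalSystem 𝒪 𝒮} {ρ : 𝒮} {A B C X Y : 𝒪}

instance isZeroOrProbabilityMeasure_P (ρ : 𝒮) (A : 𝒪) : IsZeroOrProbabilityMeasure (S.P ρ A) := by
  by_cases hρ : ρ = S.null
  · rw [hρ, S.P_null]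
    infer_instance
  · have := S.P_prob ρ A hρ
    infer_instance

theorem prob_null (A : 𝒪) (Δ : Set ℝ) : S.prob S.null A Δ = 0 := by
  rw [prob, S.P_null, measureReal_zero_apply]

theorem ne_null_of_prob_ne_zero {Δ : Set ℝ} (h : S.prob ρ A Δ ≠ 0) : ρ ≠ S.null := by
  rintro rfl
  exact h (prob_null A Δ)

theorem prob_empty (ρ : 𝒮) (A : 𝒪) : S.prob ρ A ∅ = 0 := measureReal_empty

theorem prob_nonneg (ρ : 𝒮) (A : 𝒪) (Δ : Set ℝ) : 0 ≤ S.prob ρ A Δ := measureReal_nonneg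

theorem prob_le_one (ρ : 𝒮) (A : 𝒪) (Δ : Set ℝ) : S.prob ρ A Δ ≤ 1 := measureReal_le_one

theorem prob_mono (ρ : 𝒮) (A : 𝒪) {Δ Γ : Set ℝ} (h : Δ ⊆ Γ) : S.prob ρ A Δ ≤ S.prob ρ A Γ :=
  measureReal_mono h

theorem prob_finset (ρ : 𝒮) (A : 𝒪) (Δ : Finset ℝ) :
    S.prob ρ A Δ = ∑ α ∈ Δ, S.prob ρ A {α} :=
  (sum_measureReal_singleton Δ).symm

theorem prob_pair (ρ : 𝒮) (A : 𝒪) {α β : ℝ} (h : α ≠ β) :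
    S.prob ρ A {α, β} = S.prob ρ A {α} + S.prob ρ A {β} := by
  rw [← Finset.coe_pair, prob_finset, Finset.sum_pair h]

theorem prob_eq_zero_of_prob_eq_one {α β : ℝ} (h : α ≠ β) (hα : S.prob ρ A {α} = 1) :
    S.prob ρ A {β} = 0 := by
  have hle := prob_le_one (S := S) ρ A {α, β}
  rw [prob_pair ρ A h] at hle
  linarith [prob_nonneg (S := S) ρ A {β}]

theorem eq_of_prob_eq_one {α β : ℝ} (hα : S.prob ρ A {α} = 1) (hβ : S.prob ρ A {β} = 1) :
    α = β := by
  by_contra h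
  exact zero_ne_one ((prob_eq_zero_of_prob_eq_one h hα).symm.trans hβ)

namespace FiniteDimensional

theorem ae_mem_spectrum (hfin : S.FiniteDimensional) (ρ : 𝒮) (A : 𝒪) :
    ∀ᵐ x ∂S.P ρ A, x ∈ S.spectrum A := by
  by_cases hρ : ρ = S.null
  · simp [hρ, S.P_null]
  · have := S.P_prob ρ A hρ
    exact (mem_ae_iff_prob_eq_one (hfin.finite_spectrum A).measurableSet).2
      (hfin.prob_spectrum ρ A hρ)

theorem prob_congr (hfin : S.FiniteDimensional) {Δ Γ : Set ℝ}
    (h : ∀ α ∈ S.spectrum A, α ∈ Δ ↔ α ∈ Γ) : S.prob ρ A Δ = S.prob ρ A Γ :=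
  measureReal_congr <| (hfin.ae_mem_spectrum ρ A).mono fun α hα => propext (h α hα)

theorem prob_spectrum_inter (hfin : S.FiniteDimensional) (Δ : Set ℝ) :
    S.prob ρ A (S.spectrum A ∩ Δ) = S.prob ρ A Δ :=
  hfin.prob_congr fun _ hα => and_iff_right hα

theorem prob_eq_one_of_subset (hfin : S.FiniteDimensional) (hρ : ρ ≠ S.null) {Δ : Set ℝ}
    (h : S.spectrum A ⊆ Δ) : S.prob ρ A Δ = 1 := by
  have := S.P_prob ρ A hρ
  rw [hfin.prob_congr (Γ := univ) fun α hα => iff_of_true (h hα) trivial]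
  exact probReal_univ

theorem prob_add_eq_one (hfin : S.FiniteDimensional) (hρ : ρ ≠ S.null) {α α' : ℝ} (h : α ≠ α')
    (hA : S.spectrum A ⊆ {α, α'}) : S.prob ρ A {α} + S.prob ρ A {α'} = 1 := by
  rw [← prob_pair ρ A h, hfin.prob_eq_one_of_subset hρ hA]

theorem mem_spectrum_of_prob_ne_zero (hfin : S.FiniteDimensional) {α : ℝ}
    (h : S.prob ρ A {α} ≠ 0) : α ∈ S.spectrum A := by
  by_contra hα
  refine h ?_
  rw [← hfin.prob_spectrum_inter, inter_singleton_eq_empty.2 hα, prob_empty]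

theorem mem_spectrum_of_prob_eq_one (hfin : S.FiniteDimensional) {α : ℝ}
    (h : S.prob ρ A {α} = 1) : α ∈ S.spectrum A :=
  hfin.mem_spectrum_of_prob_ne_zero (h ▸ one_ne_zero)

theorem exists_prob_ne_zero (hfin : S.FiniteDimensional) {α : ℝ} (hα : α ∈ S.spectrum A) :
    ∃ ρ, S.prob ρ A {α} ≠ 0 := by
  by_contra! hzero
  have hmem : S.spectrum A \ {α} ∈ {Δ | MeasurableSet Δ ∧ ∀ ρ, ρ ≠ S.null → S.P ρ A Δ = 1} := by
    refine ⟨(hfin.finite_spectrum A).sdiff.measurableSet, fun ρ hρ => ?_⟩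
    rw [measure_sdiff_null ((measureReal_eq_zero_iff).1 (hzero ρ)), hfin.prob_spectrum ρ A hρ]
  exact (mem_sInter.1 hα _ hmem).2 rfl

theorem spectrum_nonempty (hfin : S.FiniteDimensional) (A : 𝒪) : (S.spectrum A).Nonempty := by
  obtain ⟨ρ, hρ⟩ := S.exists_state
  rw [nonempty_iff_ne_empty]
  intro h
  have hone := hfin.prob_spectrum ρ A hρ
  rw [h, measure_empty] at hone
  exact zero_ne_one hone

theorem prob_update_self (hfin : S.FiniteDimensional) (hself : S.SelfCompatibility) {α : ℝ}
    (h : S.prob ρ A {α} ≠ 0) : S.prob (S.T {α} A ρ) A {α} = 1 := by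
  have hα := hfin.mem_spectrum_of_prob_ne_zero h
  rw [hself.cond A α hα ρ (ne_null_of_prob_ne_zero h) _ (singleton_subset_iff.2 hα), inter_self,
    div_self h]

theorem update_ne_null (hfin : S.FiniteDimensional) (hself : S.SelfCompatibility) {α : ℝ}
    (h : S.prob ρ A {α} ≠ 0) : S.T {α} A ρ ≠ S.null :=
  ne_null_of_prob_ne_zero (hfin.prob_update_self hself h ▸ one_ne_zero)

theorem exists_prob_eq_one (hfin : S.FiniteDimensional) (hself : S.SelfCompatibility) {α : ℝ}
    (hα : α ∈ S.spectrum A) : ∃ ρ, S.prob ρ A {α} = 1 :=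
  let ⟨_, hρ⟩ := hfin.exists_prob_ne_zero hα
  ⟨_, hfin.prob_update_self hself hρ⟩

end FiniteDimensional

theorem chi_eq_one_iff {Δ : Set ℝ} {x : ℝ} : chi Δ x = 1 ↔ x ∈ Δ := by
  by_cases hx : x ∈ Δ <;> simp [chi, hx]

theorem chi_mem_pair (Δ : Set ℝ) (x : ℝ) : chi Δ x ∈ ({1, 0} : Set ℝ) :=
  (indicator_eq_zero_or_self Δ (fun _ => (1 : ℝ)) x).symm

theorem chi_empty : chi ∅ = fun _ => 0 := indicator_empty _

theorem isFunctionVia_id (A : 𝒪) : S.IsFunctionVia A A id :=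
  ⟨mapsTo_id _, fun ρ _ Γ hΓ => by rw [preimage_id, inter_eq_right.2 hΓ]⟩

theorem isFunctionVia_const (hfin : S.FiniteDimensional) {b : ℝ} (hB : S.spectrum B = {b})
    (A : 𝒪) : S.IsFunctionVia B A fun _ => b := by
  refine ⟨fun _ _ => hB ▸ rfl, fun ρ hρ Γ hΓ => ?_⟩
  rcases subset_singleton_iff_eq.1 (hB ▸ hΓ) with rfl | rfl
  · rw [preimage_empty, inter_empty, prob_empty, prob_empty]
  · rw [hfin.prob_spectrum_inter, hfin.prob_eq_one_of_subset hρ hB.le,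
      hfin.prob_eq_one_of_subset hρ (preimage_const_of_mem rfl ▸ subset_univ _)]

namespace IsFunctionVia

variable {f g : ℝ → ℝ}

theorem congr (h : S.IsFunctionVia B A f) (hfg : EqOn f g (S.spectrum A)) :
    S.IsFunctionVia B A g :=
  ⟨h.1.congr hfg, fun ρ hρ Γ hΓ => by rw [h.2 ρ hρ Γ hΓ, hfg.inter_preimage_eq]⟩

theorem prob_eq (h : S.IsFunctionVia B A f) (hfin : S.FiniteDimensional) (ρ : 𝒮) (Γ : Set ℝ) :
    S.prob ρ B Γ = S.prob ρ A (f ⁻¹' Γ) := by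
  by_cases hρ : ρ = S.null
  · rw [hρ, prob_null, prob_null]
  · rw [← hfin.prob_spectrum_inter, h.2 ρ hρ _ inter_subset_left]
    exact hfin.prob_congr fun α hα => by simp [hα, h.1 hα]

theorem prob_eq_sum (h : S.IsFunctionVia B A f) (hfin : S.FiniteDimensional) (ρ : 𝒮) (β : ℝ) :
    S.prob ρ B {β} = ∑ α ∈ (hfin.finite_spectrum A).toFinset with f α = β, S.prob ρ A {α} := by
  rw [h.prob_eq hfin, ← prob_finset]
  exact hfin.prob_congr fun α hα => by simp [hα]

theorem prob_eq_one (h : S.IsFunctionVia B A f) (hfin : S.FiniteDimensional) {α : ℝ}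
    (hα : S.prob ρ A {α} = 1) : S.prob ρ B {f α} = 1 := by
  refine (prob_le_one ρ B _).antisymm ?_
  rw [h.prob_eq hfin, ← hα]
  exact prob_mono ρ A (singleton_subset_iff.2 rfl)

theorem image_spectrum (h : S.IsFunctionVia B A f) (hfin : S.FiniteDimensional) :
    f '' S.spectrum A = S.spectrum B := by
  refine h.1.image_subset.antisymm fun β hβ => ?_
  obtain ⟨ρ, hρ⟩ := hfin.exists_prob_ne_zero hβ
  by_contra hnot
  refine hρ ?_
  rw [h.prob_eq hfin, hfin.prob_congr (Γ := ∅), prob_empty]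
  exact fun α hα => iff_of_false (fun hαβ => hnot ⟨α, hα, hαβ⟩) id

theorem eqOn (hf : S.IsFunctionVia B A f) (hg : S.IsFunctionVia B A g)
    (hfin : S.FiniteDimensional) (hself : S.SelfCompatibility) : EqOn f g (S.spectrum A) := by
  intro α hα
  obtain ⟨ρ, hρ⟩ := hfin.exists_prob_eq_one hself hα
  exact eq_of_prob_eq_one (hf.prob_eq_one hfin hρ) (hg.prob_eq_one hfin hρ)

theorem unique (hA : S.IsFunctionVia A C f) (hB : S.IsFunctionVia B C f)
    (hfin : S.FiniteDimensional) (hsep : S.Separability) : A = B := by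
  refine hsep.obs_ext A B fun ρ _ => Measure.ext fun Γ _ => ?_
  rw [← measureReal_eq_measureReal_iff]
  exact (hA.prob_eq hfin ρ Γ).trans (hB.prob_eq hfin ρ Γ).symm

theorem prob_one_of_chi {Δ : Set ℝ} (h : S.IsFunctionVia B A (chi Δ))
    (hfin : S.FiniteDimensional) (ρ : 𝒮) : S.prob ρ B {1} = S.prob ρ A Δ := by
  rw [h.prob_eq hfin, show chi Δ ⁻¹' {1} = Δ from ext fun _ => chi_eq_one_iff]

end IsFunctionVia

theorem IsProjection.spectrum_subset (hA : S.IsProjection A) (hfin : S.FiniteDimensional) :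
    S.spectrum A ⊆ {1, 0} := by
  obtain ⟨C, Δ, -, hAC⟩ := hA
  rw [← hAC.image_spectrum hfin]
  exact image_subset_iff.2 fun x _ => chi_mem_pair Δ x

namespace ObservablesAndStates

theorem exists_nondegenerate_isFunctionVia (hobs : S.ObservablesAndStates) (A : 𝒪) :
    ∃ C f, S.Nondegenerate C ∧ S.IsFunctionVia A C f := by
  by_cases hA : S.Nondegenerate A
  · exact ⟨A, id, hA, isFunctionVia_id A⟩
  · obtain ⟨C, f, hC, hf, -⟩ := hobs.coarse_graining A hA
    exact ⟨C, f, hC, hf⟩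

theorem exists_isZero (hobs : S.ObservablesAndStates) (hfin : S.FiniteDimensional) :
    ∃ Z, S.IsZero Z := by
  obtain ⟨A⟩ := S.nonempty_obs
  obtain ⟨C, -, hC, -⟩ := hobs.exists_nondegenerate_isFunctionVia A
  obtain ⟨Z, hZ⟩ := hobs.functions C hC fun _ => 0
  have hspec : S.spectrum Z = {0} := by
    rw [← hZ.image_spectrum hfin, (hfin.spectrum_nonempty C).image_const]
  exact ⟨Z, fun B => chi_empty ▸ isFunctionVia_const hfin hspec B⟩

theorem exists_prob_eq_sum_expect_rankOne (hobs : S.ObservablesAndStates)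
    (hfin : S.FiniteDimensional) (X : 𝒪) (x : ℝ) :
    ∃ (s : Finset ℝ) (G : ℝ → 𝒪), (∀ a ∈ s, S.IsRankOne (G a)) ∧
      ∀ ρ, S.prob ρ X {x} = ∑ a ∈ s, S.expect ρ (G a) := by
  obtain ⟨A, f, hA, hf⟩ := hobs.exists_nondegenerate_isFunctionVia X
  choose G hG using fun a => hobs.functions A hA (chi {a})
  refine ⟨{a ∈ (hfin.finite_spectrum A).toFinset | f a = x}, G, fun a ha => ?_, fun ρ => ?_⟩
  · have haA := (hfin.finite_spectrum A).mem_toFinset.1 (Finset.mem_filter.1 ha).1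
    exact ⟨A, hA, {a}, singleton_subset_iff.2 haA, ncard_singleton a, hG a⟩
  · rw [hf.prob_eq_sum hfin]
    exact Finset.sum_congr rfl fun a _ => ((hG a).prob_one_of_chi hfin ρ).symm

end ObservablesAndStates

theorem IsRankOne.prob_mixed_ne_zero (hA : S.IsRankOne A) (hfin : S.FiniteDimensional) {m : 𝒮}
    (hm : S.IsCompletelyMixed m) : S.prob m A {1} ≠ 0 := by
  obtain ⟨C, hC, Δ, hΔ, hcard, hAC⟩ := hA
  obtain ⟨c, rfl⟩ := ncard_eq_one.1 hcard
  rw [singleton_subset_iff] at hΔ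
  have hdim : S.dim ≠ 0 := hC ▸ ncard_ne_zero_of_mem hΔ (hfin.finite_spectrum C)
  rw [hAC.prob_one_of_chi hfin, hm.2 C hC c hΔ]
  exact one_div_ne_zero (Nat.cast_ne_zero.2 hdim)

theorem IsRankOne.one_mem_spectrum (hA : S.IsRankOne A) (hfin : S.FiniteDimensional)
    (hobs : S.ObservablesAndStates) : 1 ∈ S.spectrum A :=
  let ⟨_, hm⟩ := hobs.exists_mixed
  hfin.mem_spectrum_of_prob_ne_zero (hA.prob_mixed_ne_zero hfin hm)

/-- The probability of finding `Δ` in a measurement of `A` and then `Γ` in a measurement of `B`.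
It is `seqProb` for two events, written without the trailing factor `1`, so that `Commutes` says
that it is symmetric in the two events. -/
noncomputable def pairProb (S : PhysicalSystem 𝒪 𝒮) (ρ : 𝒮) (A : 𝒪) (Δ : Set ℝ) (B : 𝒪)
    (Γ : Set ℝ) : ℝ :=
  S.prob ρ A Δ * S.prob (S.T Δ A ρ) B Γ

theorem pairProb_finset_left (hupd : S.SubjectiveUpdate) (hρ : ρ ≠ S.null) {Δ : Finset ℝ}
    (hΔ : (Δ : Set ℝ) ⊆ S.spectrum A) {Γ : Set ℝ} (hΓ : Γ ⊆ S.spectrum B) :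
    S.pairProb ρ A Δ B Γ = ∑ α ∈ Δ, S.pairProb ρ A {α} B Γ := by
  simp only [pairProb]
  rcases Γ.eq_empty_or_nonempty with rfl | hΓne
  · simp only [prob_empty, mul_zero, Finset.sum_const_zero]
  rcases Δ.eq_empty_or_nonempty with rfl | hΔne
  · simp only [Finset.coe_empty, prob_empty, zero_mul, Finset.sum_empty]
  have hmix := hupd.update A Δ hΔ hΔne ρ hρ [(Γ, B)] (List.cons_ne_nil _ _)
    (List.forall_mem_singleton.2 ⟨hΓ, hΓne⟩)
  simp only [seqProb, mul_one] at hmix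
  rw [hmix, Finset.mul_sum]
  refine Finset.sum_congr rfl fun α hα => ?_
  have hzero (h : S.prob ρ A Δ = 0) : S.prob ρ A {α} = 0 :=
    (h ▸ prob_mono ρ A (singleton_subset_iff.2 hα)).antisymm (prob_nonneg _ _ _)
  rw [← mul_assoc, mul_div_cancel_of_imp' hzero]

theorem pairProb_finset_right (ρ : 𝒮) (A : 𝒪) (Δ : Set ℝ) (B : 𝒪) (Γ : Finset ℝ) :
    S.pairProb ρ A Δ B Γ = ∑ β ∈ Γ, S.pairProb ρ A Δ B {β} := by
  simp only [pairProb, prob_finset, Finset.mul_sum]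

theorem pairProb_add_eq_prob (hfin : S.FiniteDimensional) (hself : S.SelfCompatibility) (α : ℝ)
    {β β' : ℝ} (h : β ≠ β') (hB : S.spectrum B ⊆ {β, β'}) :
    S.pairProb ρ A {α} B {β} + S.pairProb ρ A {α} B {β'} = S.prob ρ A {α} := by
  rw [pairProb, pairProb, ← mul_add]
  rcases eq_or_ne (S.prob ρ A {α}) 0 with hα | hα
  · rw [hα, zero_mul]
  · rw [hfin.prob_add_eq_one (hfin.update_ne_null hself hα) h hB, mul_one]

theorem commutes_of_pairProb_singleton (hfin : S.FiniteDimensional) (hupd : S.SubjectiveUpdate)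
    (h : ∀ ρ, ρ ≠ S.null → ∀ α ∈ S.spectrum A, ∀ β ∈ S.spectrum B,
      S.pairProb ρ A {α} B {β} = S.pairProb ρ B {β} A {α}) :
    S.Commutes A B := by
  intro ρ hρ Δ hΔ Γ hΓ
  change S.pairProb ρ A Δ B Γ = S.pairProb ρ B Γ A Δ
  lift Δ to Finset ℝ using (hfin.finite_spectrum A).subset hΔ
  lift Γ to Finset ℝ using (hfin.finite_spectrum B).subset hΓ
  rw [pairProb_finset_left hupd hρ hΔ hΓ, pairProb_finset_right]
  refine Finset.sum_congr rfl fun α hα => ?_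
  rw [pairProb_finset_right, pairProb_finset_left hupd hρ hΓ (singleton_subset_iff.2 (hΔ hα))]
  exact Finset.sum_congr rfl fun β hβ => h ρ hρ α (hΔ hα) β (hΓ hβ)

theorem Compatible.commutes (h : S.Compatible A B) (hcompat : S.CompatibilityPostulate) :
    S.Commutes A B := by
  obtain ⟨C, f, g, hf, hg⟩ := h
  intro ρ hρ Δ hΔ Γ hΓ
  have hAB := hcompat.pushforward A B C f g hf hg ρ hρ Δ hΔ Γ hΓ
  have hBA := hcompat.pushforward B A C g f hg hf ρ hρ Γ hΓ Δ hΔ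
  rw [inter_comm (g ⁻¹' Γ), ← hAB] at hBA
  simpa only [seqProb, mul_one] using hBA.symm

/-- The outcome `x` of `X` implies the outcome `y` of `Y`: every state certain of the former is
certain of the latter. Both `E ≤ F` and `E ⊥ F` are statements of this kind. The null state is
certain of nothing and need not be excluded. -/
def OutcomeImplies (S : PhysicalSystem 𝒪 𝒮) (X : 𝒪) (x : ℝ) (Y : 𝒪) (y : ℝ) : Prop :=
  ∀ ρ, S.prob ρ X {x} = 1 → S.prob ρ Y {y} = 1

theorem outcomeImplies_of_prob_le {x y : ℝ}
    (h : ∀ ρ, ρ ≠ S.null → S.prob ρ X {x} ≤ S.prob ρ Y {y}) : S.OutcomeImplies X x Y y :=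
  fun ρ hx => (prob_le_one ρ Y _).antisymm <|
    hx ▸ h ρ (ne_null_of_prob_ne_zero (hx ▸ one_ne_zero))

theorem outcomeImplies_iff_of_cone (hfin : S.FiniteDimensional) (hself : S.SelfCompatibility)
    {f g : ℝ → ℝ} (hX : S.IsFunctionVia X C f) (hY : S.IsFunctionVia Y C g) {x y : ℝ} :
    S.OutcomeImplies X x Y y ↔ ∀ c ∈ S.spectrum C, f c = x → g c = y := by
  constructor
  · rintro h c hc rfl
    obtain ⟨ρ, hρ⟩ := hfin.exists_prob_eq_one hself hc
    exact eq_of_prob_eq_one (hY.prob_eq_one hfin hρ) (h ρ (hX.prob_eq_one hfin hρ))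
  · refine fun h => outcomeImplies_of_prob_le fun ρ _ => ?_
    rw [hX.prob_eq hfin, hY.prob_eq hfin, ← hfin.prob_spectrum_inter]
    exact prob_mono ρ C fun c hc => h c hc.1 hc.2

namespace OutcomeImplies

variable {x x' y y' : ℝ}

theorem pairProb_eq_prob (h : S.OutcomeImplies X x Y y) (hfin : S.FiniteDimensional)
    (hself : S.SelfCompatibility) (ρ : 𝒮) : S.pairProb ρ X {x} Y {y} = S.prob ρ X {x} := by
  rw [pairProb]
  rcases eq_or_ne (S.prob ρ X {x}) 0 with hx | hx
  · rw [hx, zero_mul]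
  · rw [h _ (hfin.prob_update_self hself hx), mul_one]

theorem pairProb_eq_zero (h : S.OutcomeImplies X x Y y) (hfin : S.FiniteDimensional)
    (hself : S.SelfCompatibility) (hy : y ≠ y') (ρ : 𝒮) : S.pairProb ρ X {x} Y {y'} = 0 := by
  rw [pairProb]
  rcases eq_or_ne (S.prob ρ X {x}) 0 with hx | hx
  · rw [hx, zero_mul]
  · rw [prob_eq_zero_of_prob_eq_one hy (h _ (hfin.prob_update_self hself hx)), mul_zero]

theorem compatible_of_isRankOne (h : S.OutcomeImplies A 1 Y y) (hA : S.IsRankOne A)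
    (hfin : S.FiniteDimensional) (hself : S.SelfCompatibility) (hobs : S.ObservablesAndStates)
    (heig : S.EigenstatePostulate) : S.Compatible A Y := by
  obtain ⟨m, hm⟩ := hobs.exists_mixed
  have hA₁ := hA.prob_mixed_ne_zero hfin hm
  have hY : S.prob (S.projUpdate A m) Y {y} = 1 := by
    rw [projUpdate,
      inter_eq_left.2 (singleton_subset_iff.2 (hfin.mem_spectrum_of_prob_ne_zero hA₁))]
    exact h _ (hfin.prob_update_self hself hA₁)
  exact heig.compatible m hm A hA Y y (hfin.mem_spectrum_of_prob_eq_one hY) hY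

theorem pairProb_swap_eq_expect_of_isRankOne (h : S.OutcomeImplies A 1 Y y) (hA : S.IsRankOne A)
    (hfin : S.FiniteDimensional) (hself : S.SelfCompatibility) (hobs : S.ObservablesAndStates)
    (hcompat : S.CompatibilityPostulate) (heig : S.EigenstatePostulate) (hρ : ρ ≠ S.null) :
    S.pairProb ρ Y {y} A {1} = S.expect ρ A := by
  have hone := hA.one_mem_spectrum hfin hobs
  obtain ⟨τ, hτ⟩ := hfin.exists_prob_eq_one hself hone
  have hy := hfin.mem_spectrum_of_prob_eq_one (h τ hτ)
  have hcomm := (h.compatible_of_isRankOne hA hfin hself hobs heig).commutes hcompat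
  calc S.pairProb ρ Y {y} A {1} = S.pairProb ρ A {1} Y {y} :=
        (hcomm ρ hρ _ (singleton_subset_iff.2 hone) _ (singleton_subset_iff.2 hy)).symm
    _ = S.expect ρ A := h.pairProb_eq_prob hfin hself ρ

theorem pairProb_swap_eq_prob (h : S.OutcomeImplies X x Y y) (hfin : S.FiniteDimensional)
    (hself : S.SelfCompatibility) (hobs : S.ObservablesAndStates)
    (hcompat : S.CompatibilityPostulate) (heig : S.EigenstatePostulate) (hρ : ρ ≠ S.null) :
    S.pairProb ρ Y {y} X {x} = S.prob ρ X {x} := by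
  obtain ⟨s, G, hG, hsum⟩ := hobs.exists_prob_eq_sum_expect_rankOne hfin X x
  have hGY (a : ℝ) (ha : a ∈ s) : S.OutcomeImplies (G a) 1 Y y := by
    refine fun τ hτ => h τ ((prob_le_one τ X _).antisymm ?_)
    rw [hsum τ, ← hτ]
    exact Finset.single_le_sum (f := fun a => S.expect τ (G a))
      (fun _ _ => prob_nonneg _ _ _) ha
  calc S.pairProb ρ Y {y} X {x} = ∑ a ∈ s, S.pairProb ρ Y {y} (G a) {1} := by
        rw [pairProb, hsum, Finset.mul_sum]
        rfl
    _ = ∑ a ∈ s, S.expect ρ (G a) := Finset.sum_congr rfl fun a ha =>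
        (hGY a ha).pairProb_swap_eq_expect_of_isRankOne (hG a ha) hfin hself hobs hcompat heig hρ
    _ = S.prob ρ X {x} := (hsum ρ).symm

theorem prob_le_prob (h : S.OutcomeImplies X x Y y) (hfin : S.FiniteDimensional)
    (hself : S.SelfCompatibility) (hobs : S.ObservablesAndStates)
    (hcompat : S.CompatibilityPostulate) (heig : S.EigenstatePostulate) (hρ : ρ ≠ S.null) :
    S.prob ρ X {x} ≤ S.prob ρ Y {y} := by
  rw [← h.pairProb_swap_eq_prob hfin hself hobs hcompat heig hρ]
  exact mul_le_of_le_one_right (prob_nonneg ρ Y _) (prob_le_one _ X _)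

theorem contrapositive (h : S.OutcomeImplies X x Y y) (hx : x ≠ x')
    (hX : S.spectrum X ⊆ {x, x'}) (hy : y ≠ y') (hfin : S.FiniteDimensional)
    (hself : S.SelfCompatibility) (hobs : S.ObservablesAndStates)
    (hcompat : S.CompatibilityPostulate) (heig : S.EigenstatePostulate) :
    S.OutcomeImplies Y y' X x' := by
  intro ρ hY
  have hρ : ρ ≠ S.null := ne_null_of_prob_ne_zero (hY ▸ one_ne_zero)
  have hle := h.prob_le_prob hfin hself hobs hcompat heig hρ
  rw [prob_eq_zero_of_prob_eq_one hy.symm hY] at hle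
  linarith [hfin.prob_add_eq_one hρ hx hX, prob_nonneg (S := S) ρ X {x}]

theorem compatible (h : S.OutcomeImplies X x Y y) (hx : x ≠ x') (hX : S.spectrum X ⊆ {x, x'})
    (hy : y ≠ y') (hY : S.spectrum Y ⊆ {y, y'}) (hfin : S.FiniteDimensional)
    (hupd : S.SubjectiveUpdate) (hself : S.SelfCompatibility) (hobs : S.ObservablesAndStates)
    (hcompat : S.CompatibilityPostulate)
    (hcomm : ∀ A B, S.Commutes A B → S.Compatible A B) (heig : S.EigenstatePostulate) :
    S.Compatible X Y := by
  refine hcomm X Y (commutes_of_pairProb_singleton hfin hupd fun ρ hρ α hα β hβ => ?_)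
  have h' := h.contrapositive hx hX hy hfin hself hobs hcompat heig
  have hxy := h.pairProb_eq_prob hfin hself ρ
  have hyx := h.pairProb_swap_eq_prob hfin hself hobs hcompat heig hρ
  have hyx' := h'.pairProb_eq_prob hfin hself ρ
  have hxy' := h'.pairProb_swap_eq_prob hfin hself hobs hcompat heig hρ
  have hXsum := hfin.prob_add_eq_one hρ hx hX
  have hYsum := hfin.prob_add_eq_one hρ hy hY
  rcases hX hα with rfl | rfl <;> rcases hY hβ with rfl | rfl
  · rw [hxy, hyx]
  · rw [h.pairProb_eq_zero hfin hself hy, h'.pairProb_eq_zero hfin hself hx.symm]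
  · linarith [pairProb_add_eq_prob (ρ := ρ) (A := X) hfin hself α hy hY,
      pairProb_add_eq_prob (ρ := ρ) (A := Y) hfin hself β hx hX]
  · rw [hxy', hyx']

end OutcomeImplies

theorem outcomeImplies_iff_prob_le (hfin : S.FiniteDimensional) (hself : S.SelfCompatibility)
    (hobs : S.ObservablesAndStates) (hcompat : S.CompatibilityPostulate)
    (heig : S.EigenstatePostulate) {x y : ℝ} :
    S.OutcomeImplies X x Y y ↔ ∀ ρ, ρ ≠ S.null → S.prob ρ X {x} ≤ S.prob ρ Y {y} :=
  ⟨fun h _ => h.prob_le_prob hfin hself hobs hcompat heig, outcomeImplies_of_prob_le⟩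

theorem IsProjection.le_iff_outcomeImplies {E F : 𝒪} (hE : S.IsProjection E)
    (hF : S.IsProjection F) (hfin : S.FiniteDimensional) (hupd : S.SubjectiveUpdate)
    (hself : S.SelfCompatibility) (hobs : S.ObservablesAndStates)
    (hcompat : S.CompatibilityPostulate) (hcomm : ∀ A B, S.Commutes A B → S.Compatible A B)
    (heig : S.EigenstatePostulate) : S.Le E F ↔ S.OutcomeImplies E 1 F 1 := by
  constructor
  · rintro ⟨⟨C, f, g, hf, hg⟩, hprod⟩
    refine (outcomeImplies_iff_of_cone hfin hself hf hg).2 fun c hc hfc => ?_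
    simpa [hfc] using (hprod C f g hf hg).eqOn hf hfin hself hc
  · intro h
    refine ⟨h.compatible one_ne_zero (hE.spectrum_subset hfin) one_ne_zero
      (hF.spectrum_subset hfin) hfin hupd hself hobs hcompat hcomm heig, fun C f g hf hg => ?_⟩
    refine hf.congr fun c hc => ?_
    rcases hE.spectrum_subset hfin (hf.1 hc) with hfc | hfc
    · simp [(outcomeImplies_iff_of_cone hfin hself hf hg).1 h c hc hfc]
    · simp [mem_singleton_iff.1 hfc]

theorem IsProjection.orthogonal_iff_outcomeImplies {E F : 𝒪} (hE : S.IsProjection E)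
    (hF : S.IsProjection F) (hfin : S.FiniteDimensional) (hupd : S.SubjectiveUpdate)
    (hself : S.SelfCompatibility) (hobs : S.ObservablesAndStates)
    (hcompat : S.CompatibilityPostulate) (hcomm : ∀ A B, S.Commutes A B → S.Compatible A B)
    (heig : S.EigenstatePostulate) : S.Orthogonal E F ↔ S.OutcomeImplies E 1 F 0 := by
  constructor
  · rintro ⟨Z, hZ, ⟨C, f, g, hf, hg⟩, hprod⟩
    refine (outcomeImplies_iff_of_cone hfin hself hf hg).2 fun c hc hfc => ?_
    simpa [hfc, chi_empty] using (hprod C f g hf hg).eqOn (hZ C) hfin hself hc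
  · intro h
    obtain ⟨Z, hZ⟩ := hobs.exists_isZero hfin
    refine ⟨Z, hZ, h.compatible one_ne_zero (hE.spectrum_subset hfin) zero_ne_one
      (pair_comm (1 : ℝ) 0 ▸ hF.spectrum_subset hfin) hfin hupd hself hobs hcompat hcomm heig,
      fun C f g hf hg => ?_⟩
    refine (hZ C).congr fun c hc => ?_
    rcases hE.spectrum_subset hfin (hf.1 hc) with hfc | hfc
    · simp [chi_empty, (outcomeImplies_iff_of_cone hfin hself hf hg).1 h c hc hfc]
    · simp [chi_empty, mem_singleton_iff.1 hfc]

theorem IsProjection.le_iff_expect_le {E F : 𝒪} (hE : S.IsProjection E)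
    (hF : S.IsProjection F) (hfin : S.FiniteDimensional) (hupd : S.SubjectiveUpdate)
    (hself : S.SelfCompatibility) (hobs : S.ObservablesAndStates)
    (hcompat : S.CompatibilityPostulate) (hcomm : ∀ A B, S.Commutes A B → S.Compatible A B)
    (heig : S.EigenstatePostulate) :
    S.Le E F ↔ ∀ ρ, ρ ≠ S.null → S.expect ρ E ≤ S.expect ρ F :=
  (hE.le_iff_outcomeImplies hF hfin hupd hself hobs hcompat hcomm heig).trans
    (outcomeImplies_iff_prob_le hfin hself hobs hcompat heig)

theorem IsProjection.orthogonal_iff_expect_add_le_one {E F : 𝒪} (hE : S.IsProjection E)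
    (hF : S.IsProjection F) (hfin : S.FiniteDimensional) (hupd : S.SubjectiveUpdate)
    (hself : S.SelfCompatibility) (hobs : S.ObservablesAndStates)
    (hcompat : S.CompatibilityPostulate) (hcomm : ∀ A B, S.Commutes A B → S.Compatible A B)
    (heig : S.EigenstatePostulate) :
    S.Orthogonal E F ↔ ∀ ρ, ρ ≠ S.null → S.expect ρ E + S.expect ρ F ≤ 1 := by
  rw [hE.orthogonal_iff_outcomeImplies hF hfin hupd hself hobs hcompat hcomm heig,
    outcomeImplies_iff_prob_le hfin hself hobs hcompat heig]
  refine forall₂_congr fun ρ hρ => ?_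
  rw [expect, expect, ← le_sub_iff_add_le,
    eq_sub_of_add_eq' (hfin.prob_add_eq_one hρ one_ne_zero (hF.spectrum_subset hfin))]

theorem Le.antisymm {E F : 𝒪} (hEF : S.Le E F) (hFE : S.Le F E) (hfin : S.FiniteDimensional)
    (hsep : S.Separability) : E = F := by
  obtain ⟨⟨C, f, g, hf, hg⟩, hE⟩ := hEF
  exact (hE C f g hf hg).unique (mul_comm g f ▸ hFE.2 C g f hg hf) hfin hsep

theorem IsProjection.isPartialOrder_le (hfin : S.FiniteDimensional) (hsep : S.Separability)
    (hupd : S.SubjectiveUpdate) (hself : S.SelfCompatibility) (hobs : S.ObservablesAndStates)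
    (hcompat : S.CompatibilityPostulate) (hcomm : ∀ A B, S.Commutes A B → S.Compatible A B)
    (heig : S.EigenstatePostulate) :
    IsPartialOrder {E : 𝒪 // S.IsProjection E} (fun E F => S.Le E.1 F.1) := by
  have hle (E F : {E : 𝒪 // S.IsProjection E}) :=
    E.2.le_iff_outcomeImplies F.2 hfin hupd hself hobs hcompat hcomm heig
  exact {
    refl := fun E => (hle E E).2 fun _ => id
    trans := fun E F G hEF hFG =>
      (hle E G).2 fun ρ => (hle F G).1 hFG ρ ∘ (hle E F).1 hEF ρ
    antisymm := fun E F hEF hFE => Subtype.ext (hEF.antisymm hFE hfin hsep) }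

end PhysicalSystem

theorem mainTheorem7_general {𝒪 : Type u} {𝒮 : Type v} (S : PhysicalSystem 𝒪 𝒮)
    (hfin : S.FiniteDimensional) (hsep : S.Separability) (hupd : S.SubjectiveUpdate)
    (hself : S.SelfCompatibility) (hobs : S.ObservablesAndStates)
    (hcompat : S.CompatibilityPostulate) (hcomm : ∀ A B, S.Commutes A B → S.Compatible A B)
    (heig : S.EigenstatePostulate) :
    (∀ E F : 𝒪, S.IsProjection E → S.IsProjection F →
      (S.Le E F ↔ ∀ ρ : 𝒮, ρ ≠ S.null → S.expect ρ E ≤ S.expect ρ F)) ∧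
    IsPartialOrder {E : 𝒪 // S.IsProjection E} (fun E F => S.Le E.1 F.1) ∧
    (∀ E F : 𝒪, S.IsProjection E → S.IsProjection F →
      (S.Orthogonal E F ↔ ∀ ρ : 𝒮, ρ ≠ S.null → S.expect ρ E + S.expect ρ F ≤ 1)) :=
  ⟨fun _ _ hE hF => hE.le_iff_expect_le hF hfin hupd hself hobs hcompat hcomm heig,
    PhysicalSystem.IsProjection.isPartialOrder_le hfin hsep hupd hself hobs hcompat hcomm heig,
    fun _ _ hE hF =>
      hE.orthogonal_iff_expect_add_le_one hF hfin hupd hself hobs hcompat hcomm heig⟩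

theorem mainTheorem7 {𝒪 : Type u} {𝒮 : Type v} (S : PhysicalSystem 𝒪 𝒮)
    (hfin : S.FiniteDimensional) (hpost : S.Postulates) :
    (∀ E F : 𝒪, S.IsProjection E → S.IsProjection F →
      (S.Le E F ↔ ∀ ρ : 𝒮, ρ ≠ S.null → S.expect ρ E ≤ S.expect ρ F)) ∧
    IsPartialOrder {E : 𝒪 // S.IsProjection E} (fun E F => S.Le E.1 F.1) ∧
    (∀ E F : 𝒪, S.IsProjection E → S.IsProjection F →
      (S.Orthogonal E F ↔ ∀ ρ : 𝒮, ρ ≠ S.null → S.expect ρ E + S.expect ρ F ≤ 1)) :=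
  mainTheorem7_general S hfin hpost.separability hpost.subjectiveUpdate hpost.selfCompatibility
    hpost.observables hpost.compatibility hpost.commutativity hpost.eigenstates
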